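/- Let $m_0,m$ be the numbers of phases in level $0$ and in each level $k\ge 1$, and let $$Q=\begin{pmatrix}B_1&B_0&&&\\ B_2&A_1&A_0&&\\ &A_2&A_1&A_0&\\ &&A_2&A_1&A_0\\ &&&\ddots&\ddots&\ddots\end{pmatrix}$$ be the infinitesimal generator of a continuous-time level-independent QBD process, where $B_1$ is $m_0\times m_0$, $B_0$ is $m_0\times m$, $B_2$ is $m\times m_0$ and $A_0,A_1,A_2$ are $m\times m$; that is, the off-diagonal entries of $Q$ are nonnegative and its row sums are zero. Assume that the process is irreducible and positive recurrent, with stationary probability vector $x=(x_0,x_1,x_2,\ldots)$ (so $x\ge 0$, $xQ=0$, and the entries of $x$ sum to $1$), and let $\pi_n=\sum_{j=n}^{\infty}x_j$ for $n\ge 1$. Define $\Psi_0=A_0+A_1$ and, for $k\ge 1$, $$\Psi_k=A_1+A_2(-\Psi_{k-1}^{-1})A_0,\qquad \mathbf R_k=A_2(-\Psi_{k-1}^{-1}),\qquad \mathbf G_{k-1}=(-\Psi_{k-1}^{-1})A_0,$$ $$X_k^{(l)}=\mathbf R_l\mathbf R_{l-1}\cdots\mathbf R_{l-k+1}\ (l\ge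 k\ge 1),\qquad Y_k^{(l)}=\mathbf G_l\mathbf G_{l+1}\cdots\mathbf G_{l+k-1}\ (k\ge 1,\ l\ge 0).$$ Then every $\Psi_k$, $k\ge 0$, is invertible (so that these definitions make sense), the matrix series below converge, and $$\pi_1=x_0B_0\Bigl[(-\Psi_0^{-1})+\sum_{k=1}^{\infty}Y_k^{(0)}(-\Psi_k^{-1})X_k^{(k)}\Bigr],$$ and for every $n\ge 2$ $$\pi_n=x_0B_0\Bigl[Y_{n-1}^{(0)}(-\Psi_{n-1}^{-1})+\sum_{k=n}^{\infty}Y_k^{(0)}(-\Psi_k^{-1})X_{k-(n-1)}^{(k)}\Bigr].$$ -/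

import Mathlib

namespace QBD

open Matrix

/-- State space of a quasi-birth-death process with `m₀` phases in level `0` and `m` phases in
each level `≥ 1`: `Sum.inl i` is phase `i` of level `0`, and `Sum.inr (k, i)` is phase `i` of
level `k + 1`. -/
abbrev State (m₀ m : ℕ) : Type := Fin m₀ ⊕ (ℕ × Fin m)

/-- The block tridiagonal matrix with first block row `(B₁, B₀)`, second block row
`(B₂, A₁, A₀)` and all later block rows `(A₂, A₁, A₀)`. -/
def blockMatrix {m₀ m : ℕ} (B₁ : Matrix (Fin m₀) (Fin m₀) ℝ) (B₀ : Matrix (Fin m₀) (Fin m) ℝ)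
    (B₂ : Matrix (Fin m) (Fin m₀) ℝ) (A₀ A₁ A₂ : Matrix (Fin m) (Fin m) ℝ) :
    Matrix (State m₀ m) (State m₀ m) ℝ
  | Sum.inl i, Sum.inl j => B₁ i j
  | Sum.inl i, Sum.inr (l, j) => if l = 0 then B₀ i j else 0
  | Sum.inr (k, i), Sum.inl j => if k = 0 then B₂ i j else 0
  | Sum.inr (k, i), Sum.inr (l, j) =>
      if l = k + 1 then A₀ i j else if l = k then A₁ i j else if k = l + 1 then A₂ i j else 0

/-- `Q` is the (conservative) infinitesimal generator of a continuous-time Markov chain. -/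
structure IsGenerator {S : Type*} (Q : Matrix S S ℝ) : Prop where
  offDiag_nonneg : ∀ i j, i ≠ j → 0 ≤ Q i j
  rowSum_eq_zero : ∀ i, HasSum (fun j => Q i j) 0

/-- Irreducibility: every state leads to every other one through transitions of positive rate. -/
def IsIrreducible {S : Type*} (Q : Matrix S S ℝ) : Prop :=
  ∀ i j, Relation.ReflTransGen (fun a b => a ≠ b ∧ 0 < Q a b) i j

/-- `x` is a stationary probability vector of the generator `Q`: `x ≥ 0`, `x e = 1`, `x Q = 0`. -/
structure IsStationary {S : Type*} (Q : Matrix S S ℝ) (x : S → ℝ) : Prop where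
  nonneg : ∀ i, 0 ≤ x i
  hasSum_one : HasSum x 1
  balance : ∀ j, HasSum (fun i => x i * Q i j) 0

/-- The part `x₀` of the vector `x` at level `0`. -/
def level₀ {m₀ m : ℕ} (x : State m₀ m → ℝ) : Fin m₀ → ℝ := fun i => x (Sum.inl i)

/-- The part `x_k` of the vector `x` at level `k ≥ 1` (the value at `k = 0` is a dummy). -/
def level {m₀ m : ℕ} (x : State m₀ m → ℝ) : ℕ → Fin m → ℝ
  | 0 => 0
  | k + 1 => fun i => x (Sum.inr (k, i))

/-- The tail probability vector `π_n = ∑_{j ≥ n} x_j`, for `n ≥ 1`. -/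
noncomputable def tail {m₀ m : ℕ} (x : State m₀ m → ℝ) (n : ℕ) : Fin m → ℝ :=
  fun i => ∑' j : ℕ, level x (n + j) i

section LU

variable {m : ℕ} (A₀ A₁ A₂ : Matrix (Fin m) (Fin m) ℝ)

/-- `Ψ₀ = A₀ + A₁` and `Ψ_k = A₁ + A₂ (-Ψ_{k-1}⁻¹) A₀` for `k ≥ 1`. -/
noncomputable def Psi : ℕ → Matrix (Fin m) (Fin m) ℝ
  | 0 => A₀ + A₁
  | k + 1 => A₁ + A₂ * (-(Psi k)⁻¹) * A₀

/-- `R_k = A₂ (-Ψ_{k-1}⁻¹)` for `k ≥ 1` (the value at `k = 0` is a dummy). -/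
noncomputable def R : ℕ → Matrix (Fin m) (Fin m) ℝ
  | 0 => 0
  | k + 1 => A₂ * (-(Psi A₀ A₁ A₂ k)⁻¹)

/-- `G_k = (-Ψ_k⁻¹) A₀` for `k ≥ 0`. -/
noncomputable def G (k : ℕ) : Matrix (Fin m) (Fin m) ℝ :=
  (-(Psi A₀ A₁ A₂ k)⁻¹) * A₀

/-- `X_k^{(l)} = R_l R_{l-1} ⋯ R_{l-k+1}`, for `l ≥ k ≥ 1`. -/
noncomputable def X (l k : ℕ) : Matrix (Fin m) (Fin m) ℝ :=
  ((List.range k).map (fun i => R A₀ A₁ A₂ (l - i))).prod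

/-- `Y_k^{(l)} = G_l G_{l+1} ⋯ G_{l+k-1}`, for `k ≥ 1`, `l ≥ 0`. -/
noncomputable def Y (l k : ℕ) : Matrix (Fin m) (Fin m) ℝ :=
  ((List.range k).map (fun i => G A₀ A₁ A₂ (l + i))).prod

end LU

end QBD

/-!
Let `L` be the block tridiagonal matrix with first block row `(A₀ + A₁, A₀)` and later block rows
`(A₂, A₁, A₀)`. Summing the balance equations over the levels above `n` shows that
`p = (π₁, π₂, …)` solves `p L = (-x₀ B₀, 0, 0, …)`, and block elimination of this system from its
first level upwards has the pivots `Ψ_k`. A vector `q ≥ 0` with `q L ≤ 0`, strictly at level `k`,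
forces `-Ψ_k` to be a nonsingular M-matrix and bounds the partial sums of the series. Such a `q`
arises from `p` by repeatedly applying `L + C`, which spreads the strict inequality along the
transitions of the irreducible chain.

The sum of the series solves the same system and lies between `0` and `p`, so it remains to see
that `z L = 0` and `z → 0` imply `z = 0`. By Kato's inequality the absolute differences
`|z_n - z_{n+1}|`, extended by `0` at level `0`, form a vector `u` with `u Q ≥ 0`. The net flow of
`u` from each level to the next is then nonpositive at level `0`, nonincreasing, and tends to `0`.
Hence it vanishes identically and `u Q = 0`. As `u` vanishes at level `0`, it vanishes everywhere by
irreducibility.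
-/

namespace QBD

open Matrix Filter Topology

/-- A Metzler matrix has nonnegative off-diagonal entries; the negatives of the nonsingular ones
considered below are M-matrices. -/
def IsMetzler {ι 𝕜 : Type*} [Zero 𝕜] [LE 𝕜] (M : Matrix ι ι 𝕜) : Prop :=
  ∀ i j, i ≠ j → 0 ≤ M i j

section Nonneg

variable {ι κ 𝕜 : Type*} [Fintype ι] [Semiring 𝕜] [PartialOrder 𝕜]

theorem vecMul_pos [IsStrictOrderedRing 𝕜] {u : ι → 𝕜} {T : Matrix ι κ 𝕜} (hu : 0 ≤ u)
    (hT : ∀ i j, 0 ≤ T i j) {i : ι} {j : κ} (hi : 0 < u i) (hij : 0 < T i j) : 0 < (u ᵥ* T) j :=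
  Finset.sum_pos' (fun k _ => mul_nonneg (hu k) (hT k j)) ⟨i, Finset.mem_univ i, mul_pos hi hij⟩

variable [IsOrderedRing 𝕜]

theorem vecMul_nonneg {u : ι → 𝕜} {T : Matrix ι κ 𝕜} (hu : 0 ≤ u) (hT : ∀ i j, 0 ≤ T i j) :
    0 ≤ u ᵥ* T :=
  fun j => dotProduct_nonneg_of_nonneg hu fun i => hT i j

theorem vecMul_le_vecMul {u v : ι → 𝕜} {T : Matrix ι κ 𝕜} (huv : u ≤ v)
    (hT : ∀ i j, 0 ≤ T i j) : u ᵥ* T ≤ v ᵥ* T :=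
  fun j => dotProduct_le_dotProduct_of_nonneg_right huv fun i => hT i j

theorem mul_entries_nonneg {ν : Type*} {M : Matrix κ ι 𝕜} {N : Matrix ι ν 𝕜}
    (hM : ∀ i j, 0 ≤ M i j) (hN : ∀ i j, 0 ≤ N i j) (i : κ) (j : ν) : 0 ≤ (M * N) i j :=
  dotProduct_nonneg_of_nonneg (hM i) fun k => hN k j

theorem list_prod_entries_nonneg [DecidableEq ι] {l : List (Matrix ι ι 𝕜)}
    (hl : ∀ M ∈ l, ∀ i j, 0 ≤ M i j) : ∀ i j, 0 ≤ l.prod i j :=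
  List.prod_induction (fun M : Matrix ι ι 𝕜 => ∀ i j, 0 ≤ M i j) (fun _ _ => mul_entries_nonneg)
    (fun _ _ => by rw [Matrix.one_apply]; split_ifs <;> simp) hl

theorem IsMetzler.vecMul_nonneg_of_eq_zero {M : Matrix ι ι 𝕜} (hM : IsMetzler M) {u : ι → 𝕜}
    (hu : 0 ≤ u) {j : ι} (hj : u j = 0) : 0 ≤ (u ᵥ* M) j := by
  refine Finset.sum_nonneg fun i _ => ?_
  rcases eq_or_ne i j with rfl | hij
  · simp [hj]
  · exact mul_nonneg (hu i) (hM i j hij)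

theorem IsMetzler.pos_of_vecMul_neg {M : Matrix ι ι 𝕜} (hM : IsMetzler M) {q : ι → 𝕜}
    (hq : 0 ≤ q) {j : ι} (hqM : (q ᵥ* M) j < 0) : 0 < q j :=
  (hq j).lt_of_ne fun h => hqM.not_ge (hM.vecMul_nonneg_of_eq_zero hq h.symm)

end Nonneg

section Metzler

variable {ι 𝕜 : Type*} [Fintype ι] [Field 𝕜] [LinearOrder 𝕜] [IsStrictOrderedRing 𝕜]
  {M : Matrix ι ι 𝕜}

theorem IsMetzler.nonneg_of_vecMul_nonpos (hM : IsMetzler M) {q w : ι → 𝕜} (hq : 0 ≤ q)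
    (hqM : ∀ j, (q ᵥ* M) j < 0) (hwM : w ᵥ* M ≤ 0) : 0 ≤ w := by
  intro i
  by_contra! hi
  have hq_pos : ∀ j, 0 < q j := fun j => hM.pos_of_vecMul_neg hq (hqM j)
  have : Nonempty ι := ⟨i⟩
  obtain ⟨k, hk⟩ := Finite.exists_min fun j => w j / q j
  set t := w k / q k with ht
  have ht_neg : t < 0 := (hk i).trans_lt (div_neg_of_neg_of_pos hi (hq_pos i))
  -- `w - t q` is nonnegative and vanishes at `k`, where its image under `M` would be negative.
  have hu : 0 ≤ w - t • q := fun j => by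
    simpa using (le_div_iff₀ (hq_pos j)).1 (hk j)
  have huk : (w - t • q) k = 0 := by
    simp [ht, div_mul_cancel₀ _ (hq_pos k).ne']
  have h := hM.vecMul_nonneg_of_eq_zero hu huk
  simp only [Matrix.sub_vecMul, Matrix.smul_vecMul, Pi.sub_apply, Pi.smul_apply, smul_eq_mul] at h
  have hwk : (w ᵥ* M) k ≤ 0 := hwM k
  linarith [mul_pos_of_neg_of_neg ht_neg (hqM k)]

variable [DecidableEq ι]

theorem IsMetzler.isUnit (hM : IsMetzler M) {q : ι → 𝕜} (hq : 0 ≤ q)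
    (hqM : ∀ j, (q ᵥ* M) j < 0) : IsUnit M := by
  refine Matrix.vecMul_injective_iff_isUnit.1 fun v w hvw => ?_
  have h : (v - w) ᵥ* M = 0 := by rw [Matrix.sub_vecMul, sub_eq_zero]; exact hvw
  have h' : (w - v) ᵥ* M = 0 := by rw [← neg_sub, Matrix.neg_vecMul, h, neg_zero]
  exact le_antisymm (sub_nonneg.1 (hM.nonneg_of_vecMul_nonpos hq hqM h'.le))
    (sub_nonneg.1 (hM.nonneg_of_vecMul_nonpos hq hqM h.le))

theorem IsMetzler.neg_inv_nonneg (hM : IsMetzler M) {q : ι → 𝕜} (hq : 0 ≤ q)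
    (hqM : ∀ j, (q ᵥ* M) j < 0) (i j : ι) : 0 ≤ (-M⁻¹) i j := by
  have hdet := (Matrix.isUnit_iff_isUnit_det M).1 (hM.isUnit hq hqM)
  refine hM.nonneg_of_vecMul_nonpos (w := (-M⁻¹).row i) hq hqM ?_ j
  have hrow : (-M⁻¹).row i ᵥ* M = -Pi.single i 1 := by
    rw [← Matrix.single_one_vecMul i (-M⁻¹), Matrix.vecMul_vecMul, Matrix.neg_mul,
      Matrix.nonsing_inv_mul M hdet, Matrix.vecMul_neg, Matrix.vecMul_one]
  rw [hrow, neg_nonpos]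
  exact Pi.single_nonneg.2 zero_le_one

end Metzler

section Generator

variable {S : Type*} {Q : Matrix S S ℝ}

theorem IsIrreducible.mem_of_closed (hirr : IsIrreducible Q) {s : Set S}
    (hs : ∀ a b, a ∈ s → 0 < Q a b → b ∈ s) {a : S} (ha : a ∈ s) (b : S) : b ∈ s := by
  induction hirr a b with
  | refl => exact ha
  | tail _ hbc ih => exact hs _ _ ih hbc.2

theorem IsGenerator.eq_zero_of_hasSum_zero (hgen : IsGenerator Q) (hirr : IsIrreducible Q)
    {u : S → ℝ} (hu : 0 ≤ u) (hbal : ∀ j, HasSum (fun i => u i * Q i j) 0) {j : S}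
    (hj : u j = 0) : u = 0 := by
  have hclosed : ∀ a b, u a ≠ 0 → 0 < Q a b → u b ≠ 0 := fun a b ha hab hb => by
    have hterm : ∀ i, 0 ≤ u i * Q i b := fun i => by
      rcases eq_or_ne i b with rfl | hib
      · simp [hb]
      · exact mul_nonneg (hu i) (hgen.offDiag_nonneg i b hib)
    have h0 := congrFun ((hasSum_zero_iff_of_nonneg hterm).1 (hbal b)) a
    exact mul_ne_zero ha hab.ne' h0
  funext i
  by_contra hi
  exact hirr.mem_of_closed (s := {a | u a ≠ 0}) hclosed hi j hj

theorem IsStationary.pos {x : S → ℝ} (hgen : IsGenerator Q) (hirr : IsIrreducible Q)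
    (hx : IsStationary Q x) (j : S) : 0 < x j := by
  refine (hx.nonneg j).lt_of_ne fun hj => one_ne_zero (hx.hasSum_one.unique ?_)
  rw [hgen.eq_zero_of_hasSum_zero hirr hx.nonneg hx.balance hj.symm]
  exact hasSum_zero

/-- Kato's inequality for the generator `Q`. -/
theorem IsGenerator.sign_mul_le (hgen : IsGenerator Q) {z : S → ℝ} {j : S} {b c : ℝ}
    (hb : HasSum (fun i => z i * Q i j) b) (hc : HasSum (fun i => |z i| * Q i j) c) :
    SignType.sign (z j) * b ≤ c := by
  refine hasSum_le (fun i => ?_) (hb.mul_left _) hc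
  rw [← mul_assoc]
  rcases eq_or_ne i j with rfl | hij
  · rw [sign_mul_self]
  · refine mul_le_mul_of_nonneg_right ?_ (hgen.offDiag_nonneg i j hij)
    rcases SignType.sign (z j) with _ | _ | _ <;> simp [neg_le_abs, le_abs_self]

end Generator

section BlockMatrix

variable {m₀ m : ℕ} {B₁ : Matrix (Fin m₀) (Fin m₀) ℝ} {B₀ : Matrix (Fin m₀) (Fin m) ℝ}
  {B₂ : Matrix (Fin m) (Fin m₀) ℝ} {A₀ A₁ A₂ : Matrix (Fin m) (Fin m) ℝ}

theorem IsGenerator.B₀_nonneg (hgen : IsGenerator (blockMatrix B₁ B₀ B₂ A₀ A₁ A₂)) (i : Fin m₀)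
    (j : Fin m) : 0 ≤ B₀ i j := by
  simpa [blockMatrix] using hgen.offDiag_nonneg (Sum.inl i) (Sum.inr (0, j)) (by simp)

theorem IsGenerator.A₀_nonneg (hgen : IsGenerator (blockMatrix B₁ B₀ B₂ A₀ A₁ A₂)) (i j : Fin m) :
    0 ≤ A₀ i j := by
  simpa [blockMatrix] using hgen.offDiag_nonneg (Sum.inr (0, i)) (Sum.inr (1, j)) (by simp)

theorem IsGenerator.A₂_nonneg (hgen : IsGenerator (blockMatrix B₁ B₀ B₂ A₀ A₁ A₂)) (i j : Fin m) :
    0 ≤ A₂ i j := by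
  simpa [blockMatrix] using hgen.offDiag_nonneg (Sum.inr (1, i)) (Sum.inr (0, j)) (by simp)

theorem IsGenerator.isMetzler_A₁ (hgen : IsGenerator (blockMatrix B₁ B₀ B₂ A₀ A₁ A₂)) :
    IsMetzler A₁ := fun i j hij => by
  simpa [blockMatrix] using hgen.offDiag_nonneg (Sum.inr (0, i)) (Sum.inr (0, j)) (by simpa)

theorem blockMatrix_inr_pos {k l : ℕ} {i j : Fin m}
    (h : 0 < blockMatrix B₁ B₀ B₂ A₀ A₁ A₂ (Sum.inr (k, i)) (Sum.inr (l, j))) :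
    (l = k + 1 ∧ 0 < A₀ i j) ∨ (l = k ∧ 0 < A₁ i j) ∨ (k = l + 1 ∧ 0 < A₂ i j) := by
  rw [blockMatrix] at h
  split_ifs at h with hup hstay hdown
  · exact Or.inl ⟨hup, h⟩
  · exact Or.inr (Or.inl ⟨hstay, h⟩)
  · exact Or.inr (Or.inr ⟨hdown, h⟩)
  · exact absurd h (lt_irrefl _)

theorem hasSum_ite_level (n : ℕ) (g : Fin m → ℝ) :
    HasSum (fun a : ℕ × Fin m => if a.1 = n then g a.2 else 0) (∑ i, g i) := by
  have hinj : Function.Injective (Prod.mk n : Fin m → ℕ × Fin m) := Prod.mk_right_injective n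
  refine (hinj.hasSum_iff fun a ha => if_neg fun h => ha ⟨a.2, ?_⟩).1 ?_
  · rw [← h]
  · simpa [Function.comp_def] using hasSum_fintype g

/-- The row vector `u Q` for the block tridiagonal `Q`, written out by blocks. -/
def blockVecMul (B₁ : Matrix (Fin m₀) (Fin m₀) ℝ) (B₀ : Matrix (Fin m₀) (Fin m) ℝ)
    (B₂ : Matrix (Fin m) (Fin m₀) ℝ) (A₀ A₁ A₂ : Matrix (Fin m) (Fin m) ℝ)
    (u : State m₀ m → ℝ) : State m₀ m → ℝ
  | Sum.inl j => (level₀ u ᵥ* B₁ + level u 1 ᵥ* B₂) j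
  | Sum.inr (0, j) => (level₀ u ᵥ* B₀ + level u 1 ᵥ* A₁ + level u 2 ᵥ* A₂) j
  | Sum.inr (n + 1, j) =>
      (level u (n + 1) ᵥ* A₀ + level u (n + 2) ᵥ* A₁ + level u (n + 3) ᵥ* A₂) j

theorem level₀_blockVecMul (u : State m₀ m → ℝ) :
    level₀ (blockVecMul B₁ B₀ B₂ A₀ A₁ A₂ u) = level₀ u ᵥ* B₁ + level u 1 ᵥ* B₂ := rfl

theorem level_one_blockVecMul (u : State m₀ m → ℝ) :
    level (blockVecMul B₁ B₀ B₂ A₀ A₁ A₂ u) 1 =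
      level₀ u ᵥ* B₀ + level u 1 ᵥ* A₁ + level u 2 ᵥ* A₂ := rfl

theorem level_blockVecMul (u : State m₀ m → ℝ) (n : ℕ) :
    level (blockVecMul B₁ B₀ B₂ A₀ A₁ A₂ u) (n + 2) =
      level u (n + 1) ᵥ* A₀ + level u (n + 2) ᵥ* A₁ + level u (n + 3) ᵥ* A₂ := rfl

theorem hasSum_blockVecMul (u : State m₀ m → ℝ) (j : State m₀ m) :
    HasSum (fun i => u i * blockMatrix B₁ B₀ B₂ A₀ A₁ A₂ i j)
      (blockVecMul B₁ B₀ B₂ A₀ A₁ A₂ u j) := by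
  rcases j with j | ⟨_ | n, j⟩
  · refine HasSum.sum (hasSum_fintype fun i => level₀ u i * B₁ i j) ?_
    convert hasSum_ite_level 0 (fun i => level u 1 i * B₂ i j) using 1
    · funext ⟨k, i⟩
      simp only [Function.comp, blockMatrix]
      split_ifs <;> simp_all [level]
    · rfl
  · simp only [blockVecMul, Pi.add_apply, add_assoc]
    refine HasSum.sum (hasSum_fintype fun i => level₀ u i * B₀ i j) ?_
    convert (hasSum_ite_level 0 (fun i => level u 1 i * A₁ i j)).add
      (hasSum_ite_level 1 (fun i => level u 2 i * A₂ i j)) using 1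
    · funext ⟨k, i⟩
      simp only [Function.comp, blockMatrix]
      split_ifs <;> first | omega | (exfalso; assumption) | (subst_vars; simp [level])
    · rfl
  · rw [← zero_add (blockVecMul ..)]
    refine HasSum.sum (by simp [Function.comp_def, blockMatrix, hasSum_zero]) ?_
    convert ((hasSum_ite_level n (fun i => level u (n + 1) i * A₀ i j)).add
      (hasSum_ite_level (n + 1) (fun i => level u (n + 2) i * A₁ i j))).add
      (hasSum_ite_level (n + 2) (fun i => level u (n + 3) i * A₂ i j)) using 1
    · funext ⟨k, i⟩
      simp only [Function.comp, blockMatrix]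
      split_ifs <;> first | omega | (subst_vars; simp [level])
    · rfl

theorem IsStationary.blockVecMul_eq_zero {x : State m₀ m → ℝ}
    (hx : IsStationary (blockMatrix B₁ B₀ B₂ A₀ A₁ A₂) x) :
    blockVecMul B₁ B₀ B₂ A₀ A₁ A₂ x = 0 :=
  funext fun j => (hasSum_blockVecMul x j).unique (hx.balance j)

theorem IsGenerator.B₁_mulVec_one (hgen : IsGenerator (blockMatrix B₁ B₀ B₂ A₀ A₁ A₂)) :
    B₁ *ᵥ 1 = -(B₀ *ᵥ 1) := by
  refine eq_neg_of_add_eq_zero_left (funext fun i => ?_)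
  simp only [Pi.add_apply, Matrix.mulVec, dotProduct_one]
  refine HasSum.unique ?_ (hgen.rowSum_eq_zero (Sum.inl i))
  exact HasSum.sum (hasSum_fintype (B₁ i)) (hasSum_ite_level 0 (B₀ i))

theorem IsGenerator.mulVec_one_level_one
    (hgen : IsGenerator (blockMatrix B₁ B₀ B₂ A₀ A₁ A₂)) :
    B₂ *ᵥ 1 + (A₀ *ᵥ 1 + A₁ *ᵥ 1) = 0 := by
  funext i
  simp only [Pi.add_apply, Matrix.mulVec, dotProduct_one]
  refine HasSum.unique ?_ (hgen.rowSum_eq_zero (Sum.inr (0, i)))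
  refine HasSum.sum (hasSum_fintype (B₂ i)) ?_
  convert (hasSum_ite_level 1 (A₀ i)).add (hasSum_ite_level 0 (A₁ i)) using 1
  funext ⟨k, j⟩
  simp only [Function.comp, blockMatrix]
  split_ifs <;> first | omega | simp_all

theorem IsGenerator.mulVec_one_level_two
    (hgen : IsGenerator (blockMatrix B₁ B₀ B₂ A₀ A₁ A₂)) :
    A₂ *ᵥ 1 + (A₀ *ᵥ 1 + A₁ *ᵥ 1) = 0 := by
  funext i
  simp only [Pi.add_apply, Matrix.mulVec, dotProduct_one]
  rw [← zero_add (_ + _)]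
  refine HasSum.unique ?_ (hgen.rowSum_eq_zero (Sum.inr (1, i)))
  refine HasSum.sum (by simp [Function.comp_def, blockMatrix, hasSum_zero]) ?_
  convert (hasSum_ite_level 0 (A₂ i)).add
    ((hasSum_ite_level 2 (A₀ i)).add (hasSum_ite_level 1 (A₁ i))) using 1
  funext ⟨k, j⟩
  simp only [Function.comp, blockMatrix]
  split_ifs <;> first | omega | simp

theorem IsGenerator.A₁_mulVec_one (hgen : IsGenerator (blockMatrix B₁ B₀ B₂ A₀ A₁ A₂)) :
    A₁ *ᵥ 1 = -(A₀ *ᵥ 1) - A₂ *ᵥ 1 := by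
  linear_combination (exp := 1) hgen.mulVec_one_level_two

theorem IsGenerator.B₂_mulVec_one (hgen : IsGenerator (blockMatrix B₁ B₀ B₂ A₀ A₁ A₂)) :
    B₂ *ᵥ 1 = A₂ *ᵥ 1 :=
  add_right_cancel (hgen.mulVec_one_level_one.trans hgen.mulVec_one_level_two.symm)

theorem IsGenerator.nonempty_level₀ (hgen : IsGenerator (blockMatrix B₁ B₀ B₂ A₀ A₁ A₂))
    (hirr : IsIrreducible (blockMatrix B₁ B₀ B₂ A₀ A₁ A₂)) (i : Fin m) : Nonempty (Fin m₀) := by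
  by_contra! hempty
  have hA₂ : ∀ a b, A₂ a b = 0 := fun a b => by
    have hrow : ∑ b, A₂ a b = 0 := by
      simpa [Matrix.mulVec, dotProduct_one] using (congrFun hgen.B₂_mulVec_one a).symm
    exact (Finset.sum_eq_zero_iff_of_nonneg fun b _ => hgen.A₂_nonneg a b).1 hrow b
      (Finset.mem_univ b)
  refine absurd (hirr.mem_of_closed (s := {b | ∃ k j, b = Sum.inr (k + 1, j)}) ?_
    (a := Sum.inr (1, i)) ⟨0, i, rfl⟩ (Sum.inr (0, i))) (by simp)
  rintro _ (c | ⟨l, c⟩) ⟨k, j, rfl⟩ hpos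
  · exact hempty.elim c
  · rcases blockMatrix_inr_pos hpos with ⟨rfl, -⟩ | ⟨rfl, -⟩ | ⟨-, h⟩
    · exact ⟨k + 1, c, rfl⟩
    · exact ⟨k, c, rfl⟩
    · exact absurd (hA₂ j c) h.ne'

end BlockMatrix

section Flux

variable {m₀ m : ℕ} {B₁ : Matrix (Fin m₀) (Fin m₀) ℝ} {B₀ : Matrix (Fin m₀) (Fin m) ℝ}
  {B₂ : Matrix (Fin m) (Fin m₀) ℝ} {A₀ A₁ A₂ : Matrix (Fin m) (Fin m) ℝ}

/-- The net flow of the mass `u` from level `n` to level `n + 1`. The downward flow from level `1`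
is measured by `A₂`, which has the same row sums as `B₂`. -/
def flux (B₀ : Matrix (Fin m₀) (Fin m) ℝ) (A₀ A₂ : Matrix (Fin m) (Fin m) ℝ)
    (u : State m₀ m → ℝ) : ℕ → ℝ
  | 0 => level₀ u ⬝ᵥ (B₀ *ᵥ 1) - level u 1 ⬝ᵥ (A₂ *ᵥ 1)
  | n + 1 => level u (n + 1) ⬝ᵥ (A₀ *ᵥ 1) - level u (n + 2) ⬝ᵥ (A₂ *ᵥ 1)

theorem IsGenerator.level₀_blockVecMul_dotProduct_one
    (hgen : IsGenerator (blockMatrix B₁ B₀ B₂ A₀ A₁ A₂)) (u : State m₀ m → ℝ) :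
    level₀ (blockVecMul B₁ B₀ B₂ A₀ A₁ A₂ u) ⬝ᵥ 1 = -flux B₀ A₀ A₂ u 0 := by
  simp only [level₀_blockVecMul, add_dotProduct, ← dotProduct_mulVec, hgen.B₁_mulVec_one,
    hgen.B₂_mulVec_one, dotProduct_neg, flux]
  ring

theorem IsGenerator.level_blockVecMul_dotProduct_one
    (hgen : IsGenerator (blockMatrix B₁ B₀ B₂ A₀ A₁ A₂)) (u : State m₀ m → ℝ) (n : ℕ) :
    level (blockVecMul B₁ B₀ B₂ A₀ A₁ A₂ u) (n + 1) ⬝ᵥ 1 =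
      flux B₀ A₀ A₂ u n - flux B₀ A₀ A₂ u (n + 1) := by
  cases n <;>
    simp only [zero_add, level_one_blockVecMul, level_blockVecMul, add_dotProduct,
      ← dotProduct_mulVec, hgen.A₁_mulVec_one, dotProduct_sub, dotProduct_neg, flux] <;>
    ring

theorem tendsto_flux {u : State m₀ m → ℝ} (hu : Tendsto (level u) atTop (𝓝 0)) :
    Tendsto (flux B₀ A₀ A₂ u) atTop (𝓝 0) := by
  have hdot : ∀ (v : Fin m → ℝ) (k : ℕ), Tendsto (fun n => level u (n + k) ⬝ᵥ v) atTop (𝓝 0) :=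
    fun v k => by
      have hcont : Continuous fun w : Fin m → ℝ => w ⬝ᵥ v :=
        continuous_id.dotProduct continuous_const
      simpa [Function.comp_def] using
        (hcont.tendsto 0).comp ((tendsto_add_atTop_iff_nat k).2 hu)
  rw [← tendsto_add_atTop_iff_nat 1]
  simpa [flux] using (hdot (A₀ *ᵥ 1) 1).sub (hdot (A₂ *ᵥ 1) 2)

theorem IsGenerator.flux_eq_zero (hgen : IsGenerator (blockMatrix B₁ B₀ B₂ A₀ A₁ A₂))
    {u : State m₀ m → ℝ} (hu : Tendsto (level u) atTop (𝓝 0))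
    (huQ : 0 ≤ blockVecMul B₁ B₀ B₂ A₀ A₁ A₂ u) (n : ℕ) : flux B₀ A₀ A₂ u n = 0 := by
  have hanti : Antitone (flux B₀ A₀ A₂ u) := antitone_nat_of_succ_le fun n => by
    rw [← sub_nonneg, ← hgen.level_blockVecMul_dotProduct_one]
    exact dotProduct_nonneg_of_nonneg (fun _ => huQ _) zero_le_one
  have hzero : flux B₀ A₀ A₂ u 0 ≤ 0 := by
    rw [← neg_nonneg, ← hgen.level₀_blockVecMul_dotProduct_one]
    exact dotProduct_nonneg_of_nonneg (fun _ => huQ _) zero_le_one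
  exact le_antisymm ((hanti n.zero_le).trans hzero) (hanti.le_of_tendsto (tendsto_flux hu) n)

theorem IsGenerator.blockVecMul_eq_zero_of_nonneg
    (hgen : IsGenerator (blockMatrix B₁ B₀ B₂ A₀ A₁ A₂)) {u : State m₀ m → ℝ}
    (hu : Tendsto (level u) atTop (𝓝 0)) (huQ : 0 ≤ blockVecMul B₁ B₀ B₂ A₀ A₁ A₂ u) :
    blockVecMul B₁ B₀ B₂ A₀ A₁ A₂ u = 0 := by
  have hflux := hgen.flux_eq_zero hu huQ
  funext j
  rcases j with j | ⟨n, j⟩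
  · have h := hgen.level₀_blockVecMul_dotProduct_one u
    rw [hflux, neg_zero, dotProduct_one] at h
    exact (Finset.sum_eq_zero_iff_of_nonneg fun i _ => huQ (Sum.inl i)).1 h j (Finset.mem_univ j)
  · have h := hgen.level_blockVecMul_dotProduct_one u n
    rw [hflux, hflux, sub_zero, dotProduct_one] at h
    exact (Finset.sum_eq_zero_iff_of_nonneg fun i _ => huQ (Sum.inr (n, i))).1 h j
      (Finset.mem_univ j)

theorem IsGenerator.eq_zero_of_level_blockVecMul_eq_zero
    (hgen : IsGenerator (blockMatrix B₁ B₀ B₂ A₀ A₁ A₂))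
    (hirr : IsIrreducible (blockMatrix B₁ B₀ B₂ A₀ A₁ A₂)) {y : State m₀ m → ℝ}
    (hy₀ : ∀ i, y (Sum.inl i) = 0) (hy : Tendsto (level y) atTop (𝓝 0))
    (hyQ : ∀ n, level (blockVecMul B₁ B₀ B₂ A₀ A₁ A₂ y) (n + 1) = 0) : y = 0 := by
  have hnonneg : 0 ≤ blockVecMul B₁ B₀ B₂ A₀ A₁ A₂ fun a => |y a| := fun j => by
    have h := hgen.sign_mul_le (hasSum_blockVecMul y j) (hasSum_blockVecMul _ j)
    rcases j with j | ⟨n, j⟩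
    · simpa [hy₀] using h
    · have hj : blockVecMul B₁ B₀ B₂ A₀ A₁ A₂ y (Sum.inr (n, j)) = 0 := congrFun (hyQ n) j
      simpa [hj] using h
  have hlim : Tendsto (level fun a => |y a|) atTop (𝓝 0) := by
    rw [← tendsto_add_atTop_iff_nat 1, tendsto_pi_nhds] at hy ⊢
    exact fun i => tendsto_zero_iff_abs_tendsto_zero _ |>.1 (hy i)
  have hbal := hgen.blockVecMul_eq_zero_of_nonneg hlim hnonneg
  funext j
  rcases j with j | ⟨n, j⟩
  · exact hy₀ j
  obtain ⟨i₀⟩ := hgen.nonempty_level₀ hirr j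
  have habs : (fun a => |y a|) = 0 :=
    hgen.eq_zero_of_hasSum_zero hirr (fun _ => abs_nonneg _)
      (fun j => (congrFun hbal j).subst (motive := HasSum _) (hasSum_blockVecMul _ j))
      (j := Sum.inl i₀) (by simp [hy₀])
  exact abs_eq_zero.1 (congrFun habs _)

end Flux

section TailOp

variable {m : ℕ}

/-- Right multiplication of the row vector `(z₀, z₁, …)` by the block tridiagonal matrix with
first block row `(A₀ + A₁, A₀)` and all later block rows `(A₂, A₁, A₀)`, the matrix of the system
solved by the tail probabilities `(π₁, π₂, …)`. -/
def tailOp (A₀ A₁ A₂ : Matrix (Fin m) (Fin m) ℝ) : (ℕ → Fin m → ℝ) →ₗ[ℝ] (ℕ → Fin m → ℝ) where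
  toFun z
    | 0 => z 0 ᵥ* (A₀ + A₁) + z 1 ᵥ* A₂
    | n + 1 => z n ᵥ* A₀ + z (n + 1) ᵥ* A₁ + z (n + 2) ᵥ* A₂
  map_add' z w := by
    funext n
    cases n <;> simp only [Pi.add_apply, Matrix.add_vecMul] <;> abel
  map_smul' c z := by
    funext n
    cases n <;> simp only [Pi.smul_apply, Matrix.smul_vecMul, smul_add, RingHom.id_apply]

theorem tailOp_zero (A₀ A₁ A₂ : Matrix (Fin m) (Fin m) ℝ) (z : ℕ → Fin m → ℝ) :
    tailOp A₀ A₁ A₂ z 0 = z 0 ᵥ* (A₀ + A₁) + z 1 ᵥ* A₂ := rfl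

theorem tailOp_succ (A₀ A₁ A₂ : Matrix (Fin m) (Fin m) ℝ) (z : ℕ → Fin m → ℝ) (n : ℕ) :
    tailOp A₀ A₁ A₂ z (n + 1) = z n ᵥ* A₀ + z (n + 1) ᵥ* A₁ + z (n + 2) ᵥ* A₂ := rfl

theorem tendsto_tailOp (A₀ A₁ A₂ : Matrix (Fin m) (Fin m) ℝ) {z : ℕ → Fin m → ℝ}
    (hz : Tendsto z atTop (𝓝 0)) : Tendsto (tailOp A₀ A₁ A₂ z) atTop (𝓝 0) := by
  have hmul : ∀ (T : Matrix (Fin m) (Fin m) ℝ) (k : ℕ),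
      Tendsto (fun n => z (n + k) ᵥ* T) atTop (𝓝 0) := fun T k => by
    have hcont : Continuous fun v : Fin m → ℝ => v ᵥ* T :=
      continuous_id.matrix_vecMul continuous_const
    simpa [Function.comp_def] using (hcont.tendsto 0).comp ((tendsto_add_atTop_iff_nat k).2 hz)
  rw [← tendsto_add_atTop_iff_nat 1]
  simpa [tailOp_succ] using ((hmul A₀ 0).add (hmul A₁ 1)).add (hmul A₂ 2)

variable {m₀ : ℕ} {B₁ : Matrix (Fin m₀) (Fin m₀) ℝ} {B₀ : Matrix (Fin m₀) (Fin m) ℝ}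
  {B₂ : Matrix (Fin m) (Fin m₀) ℝ} {A₀ A₁ A₂ : Matrix (Fin m) (Fin m) ℝ}
  {u x : State m₀ m → ℝ} {z : ℕ → Fin m → ℝ}

variable (B₁ B₀ B₂ A₀ A₁ A₂) in
theorem level_one_blockVecMul_of_level_eq_sub (hu : ∀ n, level u (n + 1) = z n - z (n + 1)) :
    level (blockVecMul B₁ B₀ B₂ A₀ A₁ A₂ u) 1 =
      level₀ u ᵥ* B₀ + (tailOp A₀ A₁ A₂ z 0 - tailOp A₀ A₁ A₂ z 1) := by
  rw [level_one_blockVecMul, hu 0, hu 1, tailOp_zero, tailOp_succ]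
  simp only [Matrix.sub_vecMul, Matrix.vecMul_add]
  abel

variable (B₁ B₀ B₂ A₀ A₁ A₂) in
theorem level_blockVecMul_of_level_eq_sub (hu : ∀ n, level u (n + 1) = z n - z (n + 1)) (n : ℕ) :
    level (blockVecMul B₁ B₀ B₂ A₀ A₁ A₂ u) (n + 2) =
      tailOp A₀ A₁ A₂ z (n + 1) - tailOp A₀ A₁ A₂ z (n + 2) := by
  rw [level_blockVecMul, hu n, hu (n + 1), hu (n + 2), tailOp_succ, tailOp_succ]
  simp only [Matrix.sub_vecMul]
  abel

theorem eq_zero_of_succ_eq {α : Type*} [TopologicalSpace α] [T2Space α] [Zero α] {f : ℕ → α}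
    (hf : Tendsto f atTop (𝓝 0)) (hsucc : ∀ n, f n = f (n + 1)) (n : ℕ) : f n = 0 := by
  have hconst : ∀ k, f k = f 0 := fun k => by
    induction k with
    | zero => rfl
    | succ k ih => rw [← hsucc, ih]
  rw [hconst, ← tendsto_const_nhds_iff (l := (atTop : Filter ℕ)), ← funext hconst]
  exact hf

theorem IsStationary.summable_level {Q : Matrix (State m₀ m) (State m₀ m) ℝ}
    (hx : IsStationary Q x) (i : Fin m) : Summable fun k => level x k i := by
  rw [← summable_nat_add_iff 1]
  exact hx.hasSum_one.summable.comp_injective (i := fun k : ℕ => Sum.inr (k, i))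
    (fun a b h => by simpa using h)

theorem IsStationary.level_eq_tail_sub {Q : Matrix (State m₀ m) (State m₀ m) ℝ}
    (hx : IsStationary Q x) (n : ℕ) : level x n = tail x n - tail x (n + 1) := by
  funext i
  have hs : Summable fun j => level x (n + j) i := by
    simpa only [add_comm n] using (summable_nat_add_iff n).2 (hx.summable_level i)
  simp only [tail, Pi.sub_apply]
  rw [hs.tsum_eq_zero_add]
  simp only [add_zero, add_assoc, add_comm 1, add_sub_cancel_right]

theorem IsStationary.tail_nonneg {Q : Matrix (State m₀ m) (State m₀ m) ℝ}
    (hx : IsStationary Q x) (n : ℕ) : 0 ≤ tail x n := by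
  refine fun i => tsum_nonneg fun j => ?_
  cases n + j with
  | zero => exact le_rfl
  | succ k => exact hx.nonneg _

theorem tendsto_tail_succ (x : State m₀ m → ℝ) : Tendsto (fun n => tail x (n + 1)) atTop (𝓝 0) := by
  refine (tendsto_add_atTop_iff_nat 1).2 (tendsto_pi_nhds.2 fun i => ?_)
  simpa only [tail, add_comm, Pi.zero_apply] using tendsto_sum_nat_add fun k => level x k i

theorem IsStationary.tailOp_tail_succ (hx : IsStationary (blockMatrix B₁ B₀ B₂ A₀ A₁ A₂) x)
    (n : ℕ) : tailOp A₀ A₁ A₂ (fun k => tail x (k + 1)) (n + 1) = 0 := by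
  refine eq_zero_of_succ_eq (f := fun n => tailOp A₀ A₁ A₂ (fun k => tail x (k + 1)) (n + 1))
    ((tendsto_add_atTop_iff_nat 1).2 (tendsto_tailOp A₀ A₁ A₂ (tendsto_tail_succ x)))
    (fun n => ?_) n
  rw [← sub_eq_zero, ← level_blockVecMul_of_level_eq_sub B₁ B₀ B₂ A₀ A₁ A₂
    fun n => hx.level_eq_tail_sub (n + 1), hx.blockVecMul_eq_zero]
  rfl

theorem IsStationary.tailOp_tail_zero (hx : IsStationary (blockMatrix B₁ B₀ B₂ A₀ A₁ A₂) x) :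
    tailOp A₀ A₁ A₂ (fun k => tail x (k + 1)) 0 = -(level₀ x ᵥ* B₀) := by
  have h := level_one_blockVecMul_of_level_eq_sub B₁ B₀ B₂ A₀ A₁ A₂
    fun n => hx.level_eq_tail_sub (n + 1)
  rw [hx.blockVecMul_eq_zero, hx.tailOp_tail_succ 0, sub_zero] at h
  exact eq_neg_of_add_eq_zero_right h.symm

theorem eq_zero_of_tailOp_eq_zero (hgen : IsGenerator (blockMatrix B₁ B₀ B₂ A₀ A₁ A₂))
    (hirr : IsIrreducible (blockMatrix B₁ B₀ B₂ A₀ A₁ A₂)) (hz : Tendsto z atTop (𝓝 0))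
    (hLz : tailOp A₀ A₁ A₂ z = 0) : z = 0 := by
  set y : State m₀ m → ℝ := Sum.elim 0 fun a => z a.1 a.2 - z (a.1 + 1) a.2
  have hlevel : ∀ n, level y (n + 1) = z n - z (n + 1) := fun n => rfl
  have hlim : Tendsto (level y) atTop (𝓝 0) := by
    rw [← tendsto_add_atTop_iff_nat 1]
    simpa [hlevel] using hz.sub ((tendsto_add_atTop_iff_nat 1).2 hz)
  have hyQ : ∀ n, level (blockVecMul B₁ B₀ B₂ A₀ A₁ A₂ y) (n + 1) = 0 := by
    rintro (_ | n)
    · have hy₀ : level₀ y = 0 := rfl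
      simpa [hLz, hy₀] using
        level_one_blockVecMul_of_level_eq_sub B₁ B₀ B₂ A₀ A₁ A₂ hlevel
    · simpa [hLz] using level_blockVecMul_of_level_eq_sub B₁ B₀ B₂ A₀ A₁ A₂ hlevel n
  have hy : y = 0 := hgen.eq_zero_of_level_blockVecMul_eq_zero hirr (fun _ => rfl) hlim hyQ
  refine funext (eq_zero_of_succ_eq hz fun n => ?_)
  rw [← sub_eq_zero, ← hlevel, hy]
  rfl

end TailOp

section Supersolution

variable {m : ℕ} {A₀ A₁ A₂ : Matrix (Fin m) (Fin m) ℝ}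

/-- Nonnegative supersolutions of the tail system. They serve as comparison vectors, both for the
pivots `Ψ_k` of the block elimination and for the partial sums of the series. -/
structure IsSupersolution (A₀ A₁ A₂ : Matrix (Fin m) (Fin m) ℝ) (q : ℕ → Fin m → ℝ) : Prop where
  nonneg : 0 ≤ q
  tailOp_nonpos : tailOp A₀ A₁ A₂ q ≤ 0

theorem IsSupersolution.sum {ι : Type*} {s : Finset ι} {q : ι → ℕ → Fin m → ℝ}
    (hq : ∀ k, IsSupersolution A₀ A₁ A₂ (q k)) : IsSupersolution A₀ A₁ A₂ (∑ k ∈ s, q k) where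
  nonneg := Finset.sum_nonneg fun k _ => (hq k).nonneg
  tailOp_nonpos := by
    rw [map_sum]
    exact Finset.sum_nonpos fun k _ => (hq k).tailOp_nonpos

theorem tailOp_add_smul_one (C : ℝ) (z : ℕ → Fin m → ℝ) :
    tailOp A₀ (A₁ + C • 1) A₂ z = tailOp A₀ A₁ A₂ z + C • z := by
  funext n
  cases n <;>
    simp only [tailOp_zero, tailOp_succ, Pi.add_apply, Pi.smul_apply, Matrix.vecMul_add,
      Matrix.vecMul_smul, Matrix.vecMul_one] <;>
    abel

theorem tailOp_nonneg (hA₀ : ∀ i j, 0 ≤ A₀ i j) (hA₁ : ∀ i j, 0 ≤ A₁ i j)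
    (hA₂ : ∀ i j, 0 ≤ A₂ i j) {w : ℕ → Fin m → ℝ} (hw : 0 ≤ w) : 0 ≤ tailOp A₀ A₁ A₂ w := by
  rintro (_ | n)
  · exact add_nonneg (vecMul_nonneg (hw 0) fun i j => add_nonneg (hA₀ i j) (hA₁ i j))
      (vecMul_nonneg (hw 1) hA₂)
  · exact add_nonneg (add_nonneg (vecMul_nonneg (hw n) hA₀) (vecMul_nonneg (hw (n + 1)) hA₁))
      (vecMul_nonneg (hw (n + 2)) hA₂)

theorem tailOp_pos (hA₀ : ∀ i j, 0 ≤ A₀ i j) (hA₁ : ∀ i j, 0 ≤ A₁ i j)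
    (hA₂ : ∀ i j, 0 ≤ A₂ i j) {w : ℕ → Fin m → ℝ} (hw : 0 ≤ w) {k l : ℕ} {i j : Fin m}
    (hwi : 0 < w k i)
    (h : (l = k + 1 ∧ 0 < A₀ i j) ∨ (l = k ∧ 0 < A₁ i j) ∨ (k = l + 1 ∧ 0 < A₂ i j)) :
    0 < tailOp A₀ A₁ A₂ w l j := by
  have hnonneg : ∀ {T : Matrix (Fin m) (Fin m) ℝ}, (∀ i j, 0 ≤ T i j) → ∀ n, 0 ≤ (w n ᵥ* T) j :=
    fun hT n => vecMul_nonneg (hw n) hT j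
  have hA₀₁ : ∀ i j, 0 ≤ (A₀ + A₁) i j := fun i j => add_nonneg (hA₀ i j) (hA₁ i j)
  rcases h with ⟨rfl, hij⟩ | ⟨rfl, hij⟩ | ⟨rfl, hij⟩
  · exact add_pos_of_pos_of_nonneg
      (add_pos_of_pos_of_nonneg (vecMul_pos (hw k) hA₀ hwi hij) (hnonneg hA₁ _)) (hnonneg hA₂ _)
  · cases l with
    | zero =>
      exact add_pos_of_pos_of_nonneg
        (vecMul_pos (hw 0) hA₀₁ hwi (add_pos_of_nonneg_of_pos (hA₀ i j) hij)) (hnonneg hA₂ _)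
    | succ l =>
      exact add_pos_of_pos_of_nonneg
        (add_pos_of_nonneg_of_pos (hnonneg hA₀ _) (vecMul_pos (hw _) hA₁ hwi hij)) (hnonneg hA₂ _)
  · cases l with
    | zero => exact add_pos_of_nonneg_of_pos (hnonneg hA₀₁ _) (vecMul_pos (hw _) hA₂ hwi hij)
    | succ l =>
      exact add_pos_of_nonneg_of_pos (add_nonneg (hnonneg hA₀ _) (hnonneg hA₁ _))
        (vecMul_pos (hw _) hA₂ hwi hij)

theorem IsMetzler.exists_add_smul_one_nonneg (hA₁ : IsMetzler A₁) :
    ∃ C : ℝ, 0 ≤ C ∧ ∀ i j, 0 ≤ (A₁ + C • 1 : Matrix (Fin m) (Fin m) ℝ) i j := by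
  refine ⟨∑ i, |A₁ i i|, Finset.sum_nonneg fun i _ => abs_nonneg _, fun i j => ?_⟩
  rcases eq_or_ne i j with rfl | hij
  · have h : |A₁ i i| ≤ ∑ i, |A₁ i i| :=
      Finset.single_le_sum (f := fun i => |A₁ i i|) (fun k _ => abs_nonneg _) (Finset.mem_univ i)
    simp only [Matrix.add_apply, Matrix.smul_apply, Matrix.one_apply_eq, smul_eq_mul, mul_one]
    linarith [neg_abs_le (A₁ i i)]
  · simpa [hij] using hA₁ i j hij

/-- Applying `L + C`, a nonnegative matrix commuting with `L = tailOp`, spreads the strictness of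
`L q ≤ 0` along the transitions of the chain. -/
theorem IsSupersolution.exists_spread {q : ℕ → Fin m → ℝ} (hA₀ : ∀ i j, 0 ≤ A₀ i j)
    (hA₁ : IsMetzler A₁) (hA₂ : ∀ i j, 0 ≤ A₂ i j) (hq : IsSupersolution A₀ A₁ A₂ q) :
    ∃ q', IsSupersolution A₀ A₁ A₂ q' ∧ ∀ k l i j, tailOp A₀ A₁ A₂ q k i < 0 →
      (l = k + 1 ∧ 0 < A₀ i j) ∨ (l = k ∧ 0 < A₁ i j) ∨ (k = l + 1 ∧ 0 < A₂ i j) →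
      tailOp A₀ A₁ A₂ q' l j < 0 := by
  obtain ⟨C, hC, hA₁C⟩ := hA₁.exists_add_smul_one_nonneg
  have hle : ∀ i j, A₁ i j ≤ (A₁ + C • 1 : Matrix (Fin m) (Fin m) ℝ) i j := fun i j => by
    rw [Matrix.add_apply, Matrix.smul_apply, Matrix.one_apply]
    split_ifs <;> simp [hC]
  have hdefect : 0 ≤ -tailOp A₀ A₁ A₂ q := neg_nonneg.2 hq.tailOp_nonpos
  have hcomm : tailOp A₀ A₁ A₂ (tailOp A₀ (A₁ + C • 1) A₂ q) =
      -tailOp A₀ (A₁ + C • 1) A₂ (-tailOp A₀ A₁ A₂ q) := by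
    rw [map_neg, neg_neg, tailOp_add_smul_one, tailOp_add_smul_one, map_add, map_smul]
  refine ⟨tailOp A₀ (A₁ + C • 1) A₂ q, ⟨tailOp_nonneg hA₀ hA₁C hA₂ hq.nonneg, ?_⟩,
    fun k l i j hk h => ?_⟩
  · rw [hcomm, neg_nonpos]
    exact tailOp_nonneg hA₀ hA₁C hA₂ hdefect
  · rw [hcomm]
    exact neg_neg_of_pos (tailOp_pos hA₀ hA₁C hA₂ hdefect (neg_pos.2 hk)
      (h.imp_right (Or.imp_left (And.imp_right fun hij => hij.trans_le (hle i j)))))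

variable {m₀ : ℕ} {B₁ : Matrix (Fin m₀) (Fin m₀) ℝ} {B₀ : Matrix (Fin m₀) (Fin m) ℝ}
  {B₂ : Matrix (Fin m) (Fin m₀) ℝ} {x : State m₀ m → ℝ}

theorem IsStationary.isSupersolution_tail
    (hgen : IsGenerator (blockMatrix B₁ B₀ B₂ A₀ A₁ A₂))
    (hx : IsStationary (blockMatrix B₁ B₀ B₂ A₀ A₁ A₂) x) :
    IsSupersolution A₀ A₁ A₂ fun n => tail x (n + 1) where
  nonneg n := hx.tail_nonneg (n + 1)
  tailOp_nonpos := by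
    rintro (_ | n)
    · rw [hx.tailOp_tail_zero]
      exact neg_nonpos.2 (vecMul_nonneg (fun _ => hx.nonneg _) hgen.B₀_nonneg)
    · exact (hx.tailOp_tail_succ n).le

theorem exists_supersolution_neg_at (hgen : IsGenerator (blockMatrix B₁ B₀ B₂ A₀ A₁ A₂))
    (hirr : IsIrreducible (blockMatrix B₁ B₀ B₂ A₀ A₁ A₂))
    (hx : IsStationary (blockMatrix B₁ B₀ B₂ A₀ A₁ A₂) x) (n : ℕ) (j : Fin m) :
    ∃ q, IsSupersolution A₀ A₁ A₂ q ∧ tailOp A₀ A₁ A₂ q n j < 0 := by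
  obtain ⟨i₀⟩ := hgen.nonempty_level₀ hirr j
  refine hirr.mem_of_closed (a := Sum.inl i₀) (s := {a | ∀ n j, a = Sum.inr (n, j) →
    ∃ q, IsSupersolution A₀ A₁ A₂ q ∧ tailOp A₀ A₁ A₂ q n j < 0}) ?_ (by simp) _ n j rfl
  rintro (i | ⟨k, i⟩) _ ha hpos n j rfl
  · rw [blockMatrix] at hpos
    split_ifs at hpos with hn
    · subst hn
      refine ⟨_, hx.isSupersolution_tail hgen, ?_⟩
      rw [hx.tailOp_tail_zero]
      exact neg_neg_of_pos (vecMul_pos (fun _ => hx.nonneg _) hgen.B₀_nonneg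
        (hx.pos hgen hirr (Sum.inl i)) hpos)
    · exact absurd hpos (lt_irrefl _)
  · obtain ⟨q, hq, hqk⟩ := ha k i rfl
    obtain ⟨q', hq', hspread⟩ := hq.exists_spread hgen.A₀_nonneg hgen.isMetzler_A₁ hgen.A₂_nonneg
    exact ⟨q', hq', hspread k n i j hqk (blockMatrix_inr_pos hpos)⟩

theorem exists_supersolution_neg_level (hgen : IsGenerator (blockMatrix B₁ B₀ B₂ A₀ A₁ A₂))
    (hirr : IsIrreducible (blockMatrix B₁ B₀ B₂ A₀ A₁ A₂))
    (hx : IsStationary (blockMatrix B₁ B₀ B₂ A₀ A₁ A₂) x) (n : ℕ) :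
    ∃ q, IsSupersolution A₀ A₁ A₂ q ∧ ∀ j, tailOp A₀ A₁ A₂ q n j < 0 := by
  choose q hq hneg using exists_supersolution_neg_at hgen hirr hx n
  refine ⟨∑ k, q k, IsSupersolution.sum hq, fun j => ?_⟩
  rw [map_sum, Finset.sum_apply, Finset.sum_apply]
  exact Finset.sum_neg' (fun k _ => (hq k).tailOp_nonpos n j) ⟨j, Finset.mem_univ j, hneg j⟩

end Supersolution

section Elimination

variable {m : ℕ} {A₀ A₁ A₂ : Matrix (Fin m) (Fin m) ℝ}

theorem Psi_mul_neg_inv {k : ℕ} (hU : IsUnit (Psi A₀ A₁ A₂ k)) :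
    Psi A₀ A₁ A₂ k * (-(Psi A₀ A₁ A₂ k)⁻¹) = -1 := by
  rw [Matrix.mul_neg, Matrix.mul_nonsing_inv _ ((Matrix.isUnit_iff_isUnit_det _).1 hU)]

theorem neg_inv_mul_Psi {k : ℕ} (hU : IsUnit (Psi A₀ A₁ A₂ k)) :
    -(Psi A₀ A₁ A₂ k)⁻¹ * Psi A₀ A₁ A₂ k = -1 := by
  rw [Matrix.neg_mul, Matrix.nonsing_inv_mul _ ((Matrix.isUnit_iff_isUnit_det _).1 hU)]

theorem Psi_succ (k : ℕ) : Psi A₀ A₁ A₂ (k + 1) = A₁ + R A₀ A₁ A₂ (k + 1) * A₀ := rfl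

theorem Y_zero_right (l : ℕ) : Y A₀ A₁ A₂ l 0 = 1 := by simp [Y]

theorem Y_succ (l k : ℕ) : Y A₀ A₁ A₂ l (k + 1) = Y A₀ A₁ A₂ l k * G A₀ A₁ A₂ (l + k) := by
  simp [Y, List.range_succ]

theorem X_zero_right (l : ℕ) : X A₀ A₁ A₂ l 0 = 1 := by simp [X]

theorem X_succ (l k : ℕ) : X A₀ A₁ A₂ l (k + 1) = X A₀ A₁ A₂ l k * R A₀ A₁ A₂ (l - k) := by
  simp [X, List.range_succ]

/-- The `n`-th component of the tail system applied to `z`, after eliminating the levels below `n`: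
the row operations of the block LU factorization leave the pivot `Ψ_n` and the block `A₂`. -/
noncomputable def eliminated (A₀ A₁ A₂ : Matrix (Fin m) (Fin m) ℝ) (z : ℕ → Fin m → ℝ) (n : ℕ) :
    Fin m → ℝ :=
  z n ᵥ* Psi A₀ A₁ A₂ n + z (n + 1) ᵥ* A₂

theorem eliminated_zero (z : ℕ → Fin m → ℝ) :
    eliminated A₀ A₁ A₂ z 0 = tailOp A₀ A₁ A₂ z 0 := rfl

theorem eliminated_succ {n : ℕ} (hU : IsUnit (Psi A₀ A₁ A₂ n)) (z : ℕ → Fin m → ℝ) :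
    eliminated A₀ A₁ A₂ z (n + 1) =
      tailOp A₀ A₁ A₂ z (n + 1) + eliminated A₀ A₁ A₂ z n ᵥ* G A₀ A₁ A₂ n := by
  have hpivot : z n ᵥ* Psi A₀ A₁ A₂ n ᵥ* G A₀ A₁ A₂ n = -(z n ᵥ* A₀) := by
    rw [Matrix.vecMul_vecMul, G, ← Matrix.mul_assoc, Psi_mul_neg_inv hU, Matrix.neg_mul,
      Matrix.one_mul, Matrix.vecMul_neg]
  have hR : A₂ * G A₀ A₁ A₂ n = R A₀ A₁ A₂ (n + 1) * A₀ := by rw [G, R, Matrix.mul_assoc]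
  rw [eliminated, eliminated, tailOp_succ, Psi_succ, Matrix.add_vecMul, hpivot,
    Matrix.vecMul_vecMul _ A₂, hR, Matrix.vecMul_add]
  abel

theorem eq_vecMul_R_sub_eliminated {n : ℕ} (hU : IsUnit (Psi A₀ A₁ A₂ n)) (z : ℕ → Fin m → ℝ) :
    z n = z (n + 1) ᵥ* R A₀ A₁ A₂ (n + 1) -
      eliminated A₀ A₁ A₂ z n ᵥ* (-(Psi A₀ A₁ A₂ n)⁻¹) := by
  rw [eliminated, Matrix.add_vecMul, Matrix.vecMul_vecMul, Matrix.vecMul_vecMul,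
    Psi_mul_neg_inv hU, R, Matrix.vecMul_neg, Matrix.vecMul_one]
  abel

theorem G_nonneg (hA₀ : ∀ i j, 0 ≤ A₀ i j) {k : ℕ}
    (hinv : ∀ i j, 0 ≤ (-(Psi A₀ A₁ A₂ k)⁻¹) i j) : ∀ i j, 0 ≤ G A₀ A₁ A₂ k i j :=
  mul_entries_nonneg hinv hA₀

theorem R_succ_nonneg (hA₂ : ∀ i j, 0 ≤ A₂ i j) {k : ℕ}
    (hinv : ∀ i j, 0 ≤ (-(Psi A₀ A₁ A₂ k)⁻¹) i j) : ∀ i j, 0 ≤ R A₀ A₁ A₂ (k + 1) i j :=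
  mul_entries_nonneg hA₂ hinv

/-- Block elimination of the tail system runs through nonsingular pivots `Ψ_k`, with nonnegative
factors `-Ψ_k⁻¹`, `R_{k+1}` and `G_k`. -/
structure HasNonnegFactors (A₀ A₁ A₂ : Matrix (Fin m) (Fin m) ℝ) : Prop where
  isUnit_Psi : ∀ k, IsUnit (Psi A₀ A₁ A₂ k)
  neg_inv_Psi_nonneg : ∀ k i j, 0 ≤ (-(Psi A₀ A₁ A₂ k)⁻¹) i j
  G_nonneg : ∀ k i j, 0 ≤ G A₀ A₁ A₂ k i j
  R_succ_nonneg : ∀ k i j, 0 ≤ R A₀ A₁ A₂ (k + 1) i j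

theorem isMetzler_Psi (hA₀ : ∀ i j, 0 ≤ A₀ i j) (hA₁ : IsMetzler A₁) (hA₂ : ∀ i j, 0 ≤ A₂ i j)
    {n : ℕ} (hinv : ∀ k < n, ∀ i j, 0 ≤ (-(Psi A₀ A₁ A₂ k)⁻¹) i j) :
    IsMetzler (Psi A₀ A₁ A₂ n) := by
  intro i j hij
  cases n with
  | zero => exact add_nonneg (hA₀ i j) (hA₁ i j hij)
  | succ n =>
    exact add_nonneg (hA₁ i j hij)
      (mul_entries_nonneg (R_succ_nonneg hA₂ (hinv n n.lt_succ_self)) hA₀ i j)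

theorem eliminated_le_tailOp {n : ℕ} (hU : ∀ k < n, IsUnit (Psi A₀ A₁ A₂ k))
    (hG : ∀ k < n, ∀ i j, 0 ≤ G A₀ A₁ A₂ k i j) {q : ℕ → Fin m → ℝ}
    (hq : tailOp A₀ A₁ A₂ q ≤ 0) : eliminated A₀ A₁ A₂ q n ≤ tailOp A₀ A₁ A₂ q n := by
  induction n with
  | zero => exact le_rfl
  | succ n ih =>
    have hn : eliminated A₀ A₁ A₂ q n ≤ 0 :=
      (ih (fun k hk => hU k (hk.trans n.lt_succ_self))
        fun k hk => hG k (hk.trans n.lt_succ_self)).trans (hq n)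
    have h := vecMul_le_vecMul hn (hG n n.lt_succ_self)
    rw [Matrix.zero_vecMul] at h
    rw [eliminated_succ (hU n n.lt_succ_self)]
    exact add_le_of_nonpos_right h

theorem isUnit_and_neg_inv_nonneg_Psi (hA₀ : ∀ i j, 0 ≤ A₀ i j) (hA₁ : IsMetzler A₁)
    (hA₂ : ∀ i j, 0 ≤ A₂ i j)
    (hsuper : ∀ n, ∃ q, IsSupersolution A₀ A₁ A₂ q ∧ ∀ j, tailOp A₀ A₁ A₂ q n j < 0) (n : ℕ) :
    IsUnit (Psi A₀ A₁ A₂ n) ∧ ∀ i j, 0 ≤ (-(Psi A₀ A₁ A₂ n)⁻¹) i j := by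
  induction n using Nat.strong_induction_on with
  | _ n ih =>
    obtain ⟨q, hq, hneg⟩ := hsuper n
    have hΨ : IsMetzler (Psi A₀ A₁ A₂ n) := isMetzler_Psi hA₀ hA₁ hA₂ fun k hk => (ih k hk).2
    have hle : eliminated A₀ A₁ A₂ q n ≤ tailOp A₀ A₁ A₂ q n :=
      eliminated_le_tailOp (fun k hk => (ih k hk).1) (fun k hk => G_nonneg hA₀ (ih k hk).2)
        hq.tailOp_nonpos
    have hqΨ : ∀ j, (q n ᵥ* Psi A₀ A₁ A₂ n) j < 0 := fun j =>
      (le_add_of_nonneg_right (vecMul_nonneg (hq.nonneg (n + 1)) hA₂ j)).trans_lt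
        ((hle j).trans_lt (hneg j))
    exact ⟨hΨ.isUnit (hq.nonneg n) hqΨ, hΨ.neg_inv_nonneg (hq.nonneg n) hqΨ⟩

theorem hasNonnegFactors_of_supersolutions (hA₀ : ∀ i j, 0 ≤ A₀ i j) (hA₁ : IsMetzler A₁)
    (hA₂ : ∀ i j, 0 ≤ A₂ i j)
    (hsuper : ∀ n, ∃ q, IsSupersolution A₀ A₁ A₂ q ∧ ∀ j, tailOp A₀ A₁ A₂ q n j < 0) :
    HasNonnegFactors A₀ A₁ A₂ := by
  have hpivot := isUnit_and_neg_inv_nonneg_Psi hA₀ hA₁ hA₂ hsuper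
  exact ⟨fun k => (hpivot k).1, fun k => (hpivot k).2, fun k => G_nonneg hA₀ (hpivot k).2,
    fun k => R_succ_nonneg hA₂ (hpivot k).2⟩

end Elimination

section Series

variable {m : ℕ} {A₀ A₁ A₂ : Matrix (Fin m) (Fin m) ℝ}

/-- The summand `Y_{n+k}^{(0)} (-Ψ_{n+k}⁻¹) X_k^{(n+k)}` of the series for `π_{n+1}`, where `k = 0`
gives the term in front of the sum. -/
noncomputable def seriesTerm (A₀ A₁ A₂ : Matrix (Fin m) (Fin m) ℝ) (n k : ℕ) :
    Matrix (Fin m) (Fin m) ℝ :=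
  Y A₀ A₁ A₂ 0 (n + k) * (-(Psi A₀ A₁ A₂ (n + k))⁻¹) * X A₀ A₁ A₂ (n + k) k

theorem seriesTerm_zero (n : ℕ) :
    seriesTerm A₀ A₁ A₂ n 0 = Y A₀ A₁ A₂ 0 n * (-(Psi A₀ A₁ A₂ n)⁻¹) := by
  rw [seriesTerm, X_zero_right, Matrix.mul_one, add_zero]

theorem seriesTerm_succ (n k : ℕ) :
    seriesTerm A₀ A₁ A₂ n (k + 1) = seriesTerm A₀ A₁ A₂ (n + 1) k * R A₀ A₁ A₂ (n + 1) := by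
  rw [seriesTerm, X_succ, seriesTerm, show n + (k + 1) - k = n + 1 by omega,
    show n + (k + 1) = n + 1 + k by omega, ← Matrix.mul_assoc]

theorem sum_seriesTerm_succ (n J : ℕ) :
    ∑ k ∈ Finset.range (J + 1), seriesTerm A₀ A₁ A₂ n k =
      (∑ k ∈ Finset.range J, seriesTerm A₀ A₁ A₂ (n + 1) k) * R A₀ A₁ A₂ (n + 1) +
        Y A₀ A₁ A₂ 0 n * (-(Psi A₀ A₁ A₂ n)⁻¹) := by
  rw [Finset.sum_range_succ', seriesTerm_zero, Finset.sum_mul]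
  simp only [seriesTerm_succ]

theorem tsum_seriesTerm_eq (hsum : ∀ n, Summable (seriesTerm A₀ A₁ A₂ n)) (n : ℕ) :
    ∑' k, seriesTerm A₀ A₁ A₂ n k =
      (∑' k, seriesTerm A₀ A₁ A₂ (n + 1) k) * R A₀ A₁ A₂ (n + 1) +
        Y A₀ A₁ A₂ 0 n * (-(Psi A₀ A₁ A₂ n)⁻¹) := by
  rw [(hsum n).tsum_eq_zero_add, seriesTerm_zero, ← (hsum (n + 1)).tsum_mul_right, add_comm]
  simp only [seriesTerm_succ]

theorem HasNonnegFactors.seriesTerm_nonneg (h : HasNonnegFactors A₀ A₁ A₂) (n k : ℕ) :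
    ∀ i j, 0 ≤ seriesTerm A₀ A₁ A₂ n k i j := by
  induction k generalizing n with
  | zero =>
    rw [seriesTerm_zero]
    refine mul_entries_nonneg (list_prod_entries_nonneg fun M hM => ?_) (h.neg_inv_Psi_nonneg n)
    obtain ⟨k, -, rfl⟩ := List.mem_map.1 hM
    exact h.G_nonneg _
  | succ k ih =>
    rw [seriesTerm_succ]
    exact mul_entries_nonneg (ih (n + 1)) (h.R_succ_nonneg n)

variable {q : ℕ → Fin m → ℝ} {s : Fin m → ℝ}

theorem HasNonnegFactors.eliminated_le_neg_vecMul_Y (h : HasNonnegFactors A₀ A₁ A₂)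
    (hq : tailOp A₀ A₁ A₂ q ≤ 0) (hqs : tailOp A₀ A₁ A₂ q 0 ≤ -s) (n : ℕ) :
    eliminated A₀ A₁ A₂ q n ≤ -(s ᵥ* Y A₀ A₁ A₂ 0 n) := by
  induction n with
  | zero => rwa [Y_zero_right, Matrix.vecMul_one]
  | succ n ih =>
    have hG := vecMul_le_vecMul ih (h.G_nonneg n)
    rw [Matrix.neg_vecMul, Matrix.vecMul_vecMul] at hG
    rw [eliminated_succ (h.isUnit_Psi n), Y_succ, zero_add]
    exact add_le_of_nonpos_of_le (hq (n + 1)) hG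

theorem HasNonnegFactors.vecMul_sum_seriesTerm_le (h : HasNonnegFactors A₀ A₁ A₂)
    (hq : IsSupersolution A₀ A₁ A₂ q) (hqs : tailOp A₀ A₁ A₂ q 0 ≤ -s) (n J : ℕ) :
    s ᵥ* ∑ k ∈ Finset.range J, seriesTerm A₀ A₁ A₂ n k ≤ q n := by
  induction J generalizing n with
  | zero => simpa using hq.nonneg n
  | succ J ih =>
    have hR := vecMul_le_vecMul (ih (n + 1)) (h.R_succ_nonneg n)
    have hE := vecMul_le_vecMul (h.eliminated_le_neg_vecMul_Y hq.tailOp_nonpos hqs n)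
      (h.neg_inv_Psi_nonneg n)
    calc s ᵥ* ∑ k ∈ Finset.range (J + 1), seriesTerm A₀ A₁ A₂ n k
        = (s ᵥ* ∑ k ∈ Finset.range J, seriesTerm A₀ A₁ A₂ (n + 1) k) ᵥ* R A₀ A₁ A₂ (n + 1) -
            -(s ᵥ* Y A₀ A₁ A₂ 0 n) ᵥ* (-(Psi A₀ A₁ A₂ n)⁻¹) := by
          rw [sum_seriesTerm_succ, Matrix.vecMul_add, Matrix.neg_vecMul, sub_neg_eq_add,
            Matrix.vecMul_vecMul, Matrix.vecMul_vecMul]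
      _ ≤ q (n + 1) ᵥ* R A₀ A₁ A₂ (n + 1) -
            eliminated A₀ A₁ A₂ q n ᵥ* (-(Psi A₀ A₁ A₂ n)⁻¹) := sub_le_sub hR hE
      _ = q n := (eq_vecMul_R_sub_eliminated (h.isUnit_Psi n) q).symm

theorem HasNonnegFactors.summable_seriesTerm (h : HasNonnegFactors A₀ A₁ A₂)
    (hq : IsSupersolution A₀ A₁ A₂ q) (hneg : ∀ j, tailOp A₀ A₁ A₂ q 0 j < 0) (n : ℕ) :
    Summable (seriesTerm A₀ A₁ A₂ n) := by
  refine Pi.summable.2 fun i => Pi.summable.2 fun j => ?_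
  set c : ℝ := -tailOp A₀ A₁ A₂ q 0 i
  have hc : 0 < c := neg_pos.2 (hneg i)
  have hqs : tailOp A₀ A₁ A₂ q 0 ≤ -(c • Pi.single i 1) := fun a => by
    rcases eq_or_ne a i with rfl | hai
    · simp [c]
    · simpa [hai] using (hneg a).le
  refine summable_of_sum_range_le (c := c⁻¹ * q n j) (fun k => h.seriesTerm_nonneg n k i j)
    fun J => ?_
  have hJ := h.vecMul_sum_seriesTerm_le hq hqs n J j
  rw [Matrix.smul_vecMul, Matrix.single_one_vecMul] at hJ
  simp only [Pi.smul_apply, Matrix.row_apply, Matrix.sum_apply, smul_eq_mul] at hJ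
  rwa [le_inv_mul_iff₀ hc]

theorem tendsto_vecMul_sum_seriesTerm (s : Fin m → ℝ) {n : ℕ}
    (hsum : Summable (seriesTerm A₀ A₁ A₂ n)) :
    Tendsto (fun J => s ᵥ* ∑ k ∈ Finset.range J, seriesTerm A₀ A₁ A₂ n k) atTop
      (𝓝 (s ᵥ* ∑' k, seriesTerm A₀ A₁ A₂ n k)) := by
  have hcont : Continuous fun T : Matrix (Fin m) (Fin m) ℝ => s ᵥ* T :=
    continuous_const.matrix_vecMul continuous_id
  exact (hcont.tendsto _).comp hsum.hasSum.tendsto_sum_nat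

theorem HasNonnegFactors.vecMul_tsum_seriesTerm_le (h : HasNonnegFactors A₀ A₁ A₂)
    (hq : IsSupersolution A₀ A₁ A₂ q) (hqs : tailOp A₀ A₁ A₂ q 0 ≤ -s) {n : ℕ}
    (hsum : Summable (seriesTerm A₀ A₁ A₂ n)) : s ᵥ* ∑' k, seriesTerm A₀ A₁ A₂ n k ≤ q n :=
  le_of_tendsto' (tendsto_vecMul_sum_seriesTerm s hsum) (h.vecMul_sum_seriesTerm_le hq hqs n)

theorem HasNonnegFactors.vecMul_tsum_seriesTerm_nonneg (h : HasNonnegFactors A₀ A₁ A₂)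
    (hs : 0 ≤ s) {n : ℕ} (hsum : Summable (seriesTerm A₀ A₁ A₂ n)) :
    0 ≤ s ᵥ* ∑' k, seriesTerm A₀ A₁ A₂ n k :=
  ge_of_tendsto' (tendsto_vecMul_sum_seriesTerm s hsum) fun J => vecMul_nonneg hs fun i j => by
    rw [Matrix.sum_apply]
    exact Finset.sum_nonneg fun k _ => h.seriesTerm_nonneg n k i j

theorem eliminated_vecMul_tsum_seriesTerm (hU : ∀ k, IsUnit (Psi A₀ A₁ A₂ k))
    (hsum : ∀ n, Summable (seriesTerm A₀ A₁ A₂ n)) (s : Fin m → ℝ) (n : ℕ) :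
    eliminated A₀ A₁ A₂ (fun n => s ᵥ* ∑' k, seriesTerm A₀ A₁ A₂ n k) n =
      -(s ᵥ* Y A₀ A₁ A₂ 0 n) := by
  have hR : R A₀ A₁ A₂ (n + 1) * Psi A₀ A₁ A₂ n = -A₂ := by
    rw [R, Matrix.mul_assoc, neg_inv_mul_Psi (hU n), Matrix.mul_neg, Matrix.mul_one]
  rw [eliminated, tsum_seriesTerm_eq hsum n, Matrix.vecMul_vecMul, Matrix.vecMul_vecMul,
    ← Matrix.vecMul_add, Matrix.add_mul, Matrix.mul_assoc, hR, Matrix.mul_assoc,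
    neg_inv_mul_Psi (hU n), ← Matrix.vecMul_neg]
  congr 1
  simp only [Matrix.mul_neg, Matrix.mul_one]
  abel

theorem tailOp_vecMul_tsum_seriesTerm_zero (hU : ∀ k, IsUnit (Psi A₀ A₁ A₂ k))
    (hsum : ∀ n, Summable (seriesTerm A₀ A₁ A₂ n)) (s : Fin m → ℝ) :
    tailOp A₀ A₁ A₂ (fun n => s ᵥ* ∑' k, seriesTerm A₀ A₁ A₂ n k) 0 = -s := by
  rw [← eliminated_zero, eliminated_vecMul_tsum_seriesTerm hU hsum, Y_zero_right,
    Matrix.vecMul_one]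

theorem tailOp_vecMul_tsum_seriesTerm_succ (hU : ∀ k, IsUnit (Psi A₀ A₁ A₂ k))
    (hsum : ∀ n, Summable (seriesTerm A₀ A₁ A₂ n)) (s : Fin m → ℝ) (n : ℕ) :
    tailOp A₀ A₁ A₂ (fun n => s ᵥ* ∑' k, seriesTerm A₀ A₁ A₂ n k) (n + 1) = 0 := by
  have h := eliminated_succ (hU n) fun n => s ᵥ* ∑' k, seriesTerm A₀ A₁ A₂ n k
  rw [eliminated_vecMul_tsum_seriesTerm hU hsum, eliminated_vecMul_tsum_seriesTerm hU hsum,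
    Y_succ, zero_add, Matrix.neg_vecMul, Matrix.vecMul_vecMul] at h
  exact left_eq_add.1 (by rwa [add_comm] at h)

variable {m₀ : ℕ} {B₁ : Matrix (Fin m₀) (Fin m₀) ℝ} {B₀ : Matrix (Fin m₀) (Fin m) ℝ}
  {B₂ : Matrix (Fin m) (Fin m₀) ℝ} {x : State m₀ m → ℝ}

theorem IsStationary.hasNonnegFactors (hgen : IsGenerator (blockMatrix B₁ B₀ B₂ A₀ A₁ A₂))
    (hirr : IsIrreducible (blockMatrix B₁ B₀ B₂ A₀ A₁ A₂))
    (hx : IsStationary (blockMatrix B₁ B₀ B₂ A₀ A₁ A₂) x) : HasNonnegFactors A₀ A₁ A₂ :=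
  hasNonnegFactors_of_supersolutions hgen.A₀_nonneg hgen.isMetzler_A₁ hgen.A₂_nonneg
    (exists_supersolution_neg_level hgen hirr hx)

theorem IsStationary.summable_seriesTerm (hgen : IsGenerator (blockMatrix B₁ B₀ B₂ A₀ A₁ A₂))
    (hirr : IsIrreducible (blockMatrix B₁ B₀ B₂ A₀ A₁ A₂))
    (hx : IsStationary (blockMatrix B₁ B₀ B₂ A₀ A₁ A₂) x) (n : ℕ) :
    Summable (seriesTerm A₀ A₁ A₂ n) := by
  obtain ⟨q, hq, hneg⟩ := exists_supersolution_neg_level hgen hirr hx 0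
  exact (hx.hasNonnegFactors hgen hirr).summable_seriesTerm hq hneg n

theorem IsStationary.tail_eq_vecMul_tsum (hgen : IsGenerator (blockMatrix B₁ B₀ B₂ A₀ A₁ A₂))
    (hirr : IsIrreducible (blockMatrix B₁ B₀ B₂ A₀ A₁ A₂))
    (hx : IsStationary (blockMatrix B₁ B₀ B₂ A₀ A₁ A₂) x) (n : ℕ) :
    tail x (n + 1) = (level₀ x ᵥ* B₀) ᵥ* ∑' k, seriesTerm A₀ A₁ A₂ n k := by
  set s := level₀ x ᵥ* B₀
  set p : ℕ → Fin m → ℝ := fun n => tail x (n + 1)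
  set v : ℕ → Fin m → ℝ := fun n => s ᵥ* ∑' k, seriesTerm A₀ A₁ A₂ n k
  have hfac := hx.hasNonnegFactors hgen hirr
  have hsum := hx.summable_seriesTerm hgen hirr
  have hs : 0 ≤ s := vecMul_nonneg (fun _ => hx.nonneg _) hgen.B₀_nonneg
  have hv_nonneg : ∀ n, 0 ≤ v n := fun n => hfac.vecMul_tsum_seriesTerm_nonneg hs (hsum n)
  have hv_le : ∀ n, v n ≤ p n := fun n =>
    hfac.vecMul_tsum_seriesTerm_le (hx.isSupersolution_tail hgen) hx.tailOp_tail_zero.le (hsum n)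
  have hp : Tendsto p atTop (𝓝 0) := tendsto_tail_succ x
  have hv : Tendsto v atTop (𝓝 0) := tendsto_pi_nhds.2 fun i =>
    squeeze_zero (fun n => hv_nonneg n i) (fun n => hv_le n i) (tendsto_pi_nhds.1 hp i)
  have hL : tailOp A₀ A₁ A₂ (p - v) = 0 := by
    rw [map_sub, sub_eq_zero]
    funext n
    cases n with
    | zero =>
      rw [hx.tailOp_tail_zero, tailOp_vecMul_tsum_seriesTerm_zero hfac.isUnit_Psi hsum]
    | succ n =>
      rw [hx.tailOp_tail_succ, tailOp_vecMul_tsum_seriesTerm_succ hfac.isUnit_Psi hsum]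
  have hlim : Tendsto (p - v) atTop (𝓝 0) := by
    rw [← sub_zero (0 : Fin m → ℝ)]
    exact hp.sub hv
  exact congrFun (sub_eq_zero.1 (eq_zero_of_tailOp_eq_zero hgen hirr hlim hL)) n

theorem seriesTerm_succ_eq (n j : ℕ) :
    seriesTerm A₀ A₁ A₂ n (j + 1) = Y A₀ A₁ A₂ 0 (n + 1 + j) *
      (-(Psi A₀ A₁ A₂ (n + 1 + j))⁻¹) * X A₀ A₁ A₂ (n + 1 + j) (j + 1) := by
  rw [seriesTerm, show n + (j + 1) = n + 1 + j by omega]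

theorem IsStationary.summable_and_tail_succ_eq
    (hgen : IsGenerator (blockMatrix B₁ B₀ B₂ A₀ A₁ A₂))
    (hirr : IsIrreducible (blockMatrix B₁ B₀ B₂ A₀ A₁ A₂))
    (hx : IsStationary (blockMatrix B₁ B₀ B₂ A₀ A₁ A₂) x) (n : ℕ) :
    Summable (fun j => Y A₀ A₁ A₂ 0 (n + 1 + j) * (-(Psi A₀ A₁ A₂ (n + 1 + j))⁻¹) *
        X A₀ A₁ A₂ (n + 1 + j) (j + 1)) ∧
      tail x (n + 1) = (level₀ x ᵥ* B₀) ᵥ* (Y A₀ A₁ A₂ 0 n * (-(Psi A₀ A₁ A₂ n)⁻¹) +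
        ∑' j, Y A₀ A₁ A₂ 0 (n + 1 + j) * (-(Psi A₀ A₁ A₂ (n + 1 + j))⁻¹) *
          X A₀ A₁ A₂ (n + 1 + j) (j + 1)) := by
  have hsum := hx.summable_seriesTerm hgen hirr n
  simp only [← seriesTerm_succ_eq]
  refine ⟨(summable_nat_add_iff 1).2 hsum, ?_⟩
  rw [hx.tail_eq_vecMul_tsum hgen hirr, hsum.tsum_eq_zero_add, seriesTerm_zero]

end Series

end QBD

open Matrix in
/-- In both series the summation index `k` of the formulas is `k = 1 + j`, respectively
`k = n + j` (so that `k - (n - 1) = j + 1`), with `j = 0, 1, 2, …`. -/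
theorem mainTheorem2 {m₀ m : ℕ}
    (B₁ : Matrix (Fin m₀) (Fin m₀) ℝ) (B₀ : Matrix (Fin m₀) (Fin m) ℝ)
    (B₂ : Matrix (Fin m) (Fin m₀) ℝ) (A₀ A₁ A₂ : Matrix (Fin m) (Fin m) ℝ)
    (hgen : QBD.IsGenerator (QBD.blockMatrix B₁ B₀ B₂ A₀ A₁ A₂))
    (hirr : QBD.IsIrreducible (QBD.blockMatrix B₁ B₀ B₂ A₀ A₁ A₂))
    (x : QBD.State m₀ m → ℝ)
    (hx : QBD.IsStationary (QBD.blockMatrix B₁ B₀ B₂ A₀ A₁ A₂) x) :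
    (∀ k, IsUnit (QBD.Psi A₀ A₁ A₂ k)) ∧
    (Summable (fun j : ℕ => QBD.Y A₀ A₁ A₂ 0 (1 + j) * (-(QBD.Psi A₀ A₁ A₂ (1 + j))⁻¹) *
          QBD.X A₀ A₁ A₂ (1 + j) (1 + j)) ∧
      QBD.tail x 1 = (QBD.level₀ x ᵥ* B₀) ᵥ*
        (-(QBD.Psi A₀ A₁ A₂ 0)⁻¹ + ∑' j : ℕ, QBD.Y A₀ A₁ A₂ 0 (1 + j) * (-(QBD.Psi A₀ A₁ A₂ (1 + j))⁻¹) *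
          QBD.X A₀ A₁ A₂ (1 + j) (1 + j))) ∧
    (∀ n : ℕ, 2 ≤ n →
      Summable (fun j : ℕ => QBD.Y A₀ A₁ A₂ 0 (n + j) * (-(QBD.Psi A₀ A₁ A₂ (n + j))⁻¹) *
          QBD.X A₀ A₁ A₂ (n + j) (j + 1)) ∧
      QBD.tail x n = (QBD.level₀ x ᵥ* B₀) ᵥ*
        (QBD.Y A₀ A₁ A₂ 0 (n - 1) * (-(QBD.Psi A₀ A₁ A₂ (n - 1))⁻¹) +
          ∑' j : ℕ, QBD.Y A₀ A₁ A₂ 0 (n + j) * (-(QBD.Psi A₀ A₁ A₂ (n + j))⁻¹) *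
          QBD.X A₀ A₁ A₂ (n + j) (j + 1))) := by
  have hseries := hx.summable_and_tail_succ_eq hgen hirr
  refine ⟨(hx.hasNonnegFactors hgen hirr).isUnit_Psi, ?_, fun n hn => ?_⟩
  · have hzero := hseries 0
    simp only [QBD.Y_zero_right, Matrix.one_mul] at hzero
    simpa only [zero_add, add_comm] using hzero
  · obtain ⟨l, rfl⟩ : ∃ l, n = l + 1 := ⟨n - 1, by omega⟩
    exact hseries l
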